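/- Let $1\le m\le n$ be integers and let $p=(p_1,\dots,p_n)$ be a probability distribution. For a finite probability distribution $a$ let $H(a)=-\sum_i a_i\log_2 a_i$ (with $0\log_2 0=0$). For probability distributions $p$ with $n$ components and $q$ with $m$ components let $W(p,q)$ be the minimum of $H(N)$ over all bivariate probability distributions $N$ with marginals $p$ and $q$, and put $$D(p,q)=2W(p,q)-H(p)-H(q).$$ A step of the Huffman algorithm replaces two smallest elements $x,y$ of the current list of probabilities (ties broken arbitrarily) by the single element $x+y$. Let $\bar q=(\bar q_1,\dots,\bar q_m)$ be the list, in non-increasing order, obtained from $p$ by exactly $n-m$ such steps; such a $\bar q$ always exists. Let $q^*$ be a probability distribution with $m$ components that minimizes $D(p,q)$ over all probability distributions $q$ with $m$ components; such a $q^*$ exists. Then $\bar q$ is an aggregation of $p$ into $m$ components, i.e. there is a partition of $\{1,\dots,n\}$ into nonempty sets $I_1,\dots,I_m$ with $\bar q_k=\sum_{i\in I_k}p_i$ for every $k$, and $$D(p,\bar q)\le D(p,q^*)+\alpha,\qquad \alpha=1-\frac{1+\ln(\ln 2)}{\ln 2}<0.0861 .$$ -/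

import Mathlib

namespace HuffmanApprox

/-- Shannon entropy in bits, `-∑ aᵢ log₂ aᵢ`, with the convention `0 log₂ 0 = 0`. -/
noncomputable def entropy {ι : Type*} [Fintype ι] (a : ι → ℝ) : ℝ :=
  -∑ i, a i * Real.logb 2 (a i)

/-- The bivariate probability distributions with marginals `p` and `q`. -/
def couplings {ι κ : Type*} [Fintype ι] [Fintype κ] (p : ι → ℝ) (q : κ → ℝ) :
    Set (ι × κ → ℝ) :=
  {N | N ∈ stdSimplex ℝ (ι × κ) ∧ (∀ i, ∑ j, N (i, j) = p i) ∧ (∀ j, ∑ i, N (i, j) = q j)}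

/-- The minimum entropy of a bivariate distribution with marginals `p` and `q`; the infimum is
attained, see `isLeast_minJointEntropy`. -/
noncomputable def minJointEntropy {ι κ : Type*} [Fintype ι] [Fintype κ]
    (p : ι → ℝ) (q : κ → ℝ) : ℝ :=
  sInf (entropy '' couplings p q)

/-- `D(p, q) = 2 W(p, q) - H(p) - H(q)`. -/
noncomputable def dist {ι κ : Type*} [Fintype ι] [Fintype κ] (p : ι → ℝ) (q : κ → ℝ) : ℝ :=
  2 * minJointEntropy p q - entropy p - entropy q

lemma continuous_entropy {ι : Type*} [Fintype ι] :
    Continuous (entropy : (ι → ℝ) → ℝ) := by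
  have h : Continuous fun x : ℝ => x * Real.logb 2 x := by
    have : (fun x : ℝ => x * Real.logb 2 x) = fun x => x * Real.log x / Real.log 2 := by
      funext x; simp only [Real.logb, mul_div_assoc]
    rw [this]
    exact Real.continuous_mul_log.div_const _
  unfold entropy
  exact (continuous_finsetSum _ fun i _ => h.comp (continuous_apply i)).neg

/-- For probability distributions `p` and `q`, the number `W(p, q)` is a genuine minimum. -/
theorem isLeast_minJointEntropy {ι κ : Type*} [Fintype ι] [Fintype κ]
    {p : ι → ℝ} {q : κ → ℝ} (hp : p ∈ stdSimplex ℝ ι) (hq : q ∈ stdSimplex ℝ κ) :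
    IsLeast (entropy '' couplings p q) (minJointEntropy p q) := by
  have hne : (couplings p q).Nonempty := by
    refine ⟨fun x => p x.1 * q x.2, ⟨fun x => mul_nonneg (hp.1 _) (hq.1 _), ?_⟩, ?_, ?_⟩
    · rw [Fintype.sum_prod_type]
      simp [← Finset.mul_sum, hq.2, hp.2]
    · intro i; simp [← Finset.mul_sum, hq.2]
    · intro j; simp [← Finset.sum_mul, hp.2]
  have hcl : IsClosed {N : ι × κ → ℝ |
      (∀ i, ∑ j, N (i, j) = p i) ∧ (∀ j, ∑ i, N (i, j) = q j)} := by
    simp only [Set.ofPred_and, Set.ofPred_forall]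
    refine IsClosed.inter (isClosed_iInter fun i => ?_) (isClosed_iInter fun j => ?_)
    · exact isClosed_eq (by fun_prop) continuous_const
    · exact isClosed_eq (by fun_prop) continuous_const
  have hc : IsCompact (couplings p q) := (isCompact_stdSimplex ℝ (ι × κ)).inter_right hcl
  exact (hc.image continuous_entropy).isLeast_sInf (hne.image _)

/-- `q` is a best approximation of `p` with `m` components: it minimizes `D(p, ·)` over all
probability distributions with `m` components. -/
def IsBestApprox {n m : ℕ} (p : Fin n → ℝ) (q : Fin m → ℝ) : Prop :=
  q ∈ stdSimplex ℝ (Fin m) ∧ ∀ q' ∈ stdSimplex ℝ (Fin m), dist p q ≤ dist p q'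

/-- `q` is an aggregation of `p` into `m` components. The (nonempty) blocks of the partition are
the fibres of `f`. -/
def IsAggregation {n m : ℕ} (p : Fin n → ℝ) (q : Fin m → ℝ) : Prop :=
  ∃ f : Fin n → Fin m, Function.Surjective f ∧ ∀ k, q k = ∑ i with f i = k, p i

/-- One step of the Huffman algorithm: two smallest elements `x`, `y` are deleted and replaced by
`x + y`. -/
def HuffmanStep (s t : Multiset ℝ) : Prop :=
  ∃ (x y : ℝ) (u : Multiset ℝ), s = x ::ₘ y ::ₘ u ∧ x ≤ y ∧ (∀ z ∈ u, y ≤ z) ∧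
    t = (x + y) ::ₘ u

/-- `HuffmanSteps k s t`: the multiset `t` is obtained from `s` by exactly `k` Huffman steps. -/
inductive HuffmanSteps : ℕ → Multiset ℝ → Multiset ℝ → Prop
  | zero (s : Multiset ℝ) : HuffmanSteps 0 s s
  | succ {k : ℕ} {s t u : Multiset ℝ} :
      HuffmanStep s t → HuffmanSteps k t u → HuffmanSteps (k + 1) s u

/-- `q`, listed in non-increasing order, is obtained from `p` by exactly `n - m` steps of the
Huffman algorithm (used for `m ≤ n`). -/
def IsHuffmanOutput {n m : ℕ} (p : Fin n → ℝ) (q : Fin m → ℝ) : Prop :=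
  Antitone q ∧
    HuffmanSteps (n - m) (Finset.univ.val.map p) (Finset.univ.val.map q)

/-- The constant `α = 1 - (1 + ln (ln 2)) / ln 2`. -/
noncomputable def alpha : ℝ := 1 - (1 + Real.log (Real.log 2)) / Real.log 2

end HuffmanApprox

/-! If `q` is the law of `f X`, the coupling `(X, f X)` gives `D(p, q) ≤ H(p) - H(q)`. Conversely `W
≥ H(p)` gives `D(p, q) ≥ W - H(q)`, a conditional entropy `H(X | Y)`, which is at least `H(X | f X)`
for the maximum likelihood guess `f`. So it suffices to compare entropies of aggregations.

Let `μ` be the least Huffman block sum. Merging two smallest elements keeps every composite block at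
most `2μ`, so blocks above `2μ` are single elements of `p`. Replacing `-t log t` by its defect from
the tangent at `c = 2μ log 2` shifts all aggregate entropies by one constant. For any partition, the
total defect is at most that of the elements forming the heavy Huffman blocks
(`tangentDefect_le_sum`). The other Huffman blocks lie in `[μ, 2μ]` and lose at most `α log 2` per
unit mass. -/

namespace HuffmanApprox

open Real Finset

/-! ### Entropy and couplings -/

/-- The distribution of `f X` when `X` has distribution `p`. -/
noncomputable def fiberSum {ι κ : Type*} [Fintype ι] [DecidableEq κ]
    (p : ι → ℝ) (f : ι → κ) (k : κ) : ℝ := ∑ i with f i = k, p i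

section Coupling

variable {ι κ : Type*}

lemma entropy_eq_sum_negMulLog [Fintype ι] (a : ι → ℝ) :
    entropy a = (∑ i, negMulLog (a i)) / log 2 := by
  simp only [entropy, negMulLog, logb, sum_div, ← sum_neg_distrib]
  exact sum_congr rfl fun i _ => by ring

lemma negMulLog_sum_le {s : Finset ι} {a : ι → ℝ} (ha : ∀ i ∈ s, 0 ≤ a i) :
    negMulLog (∑ i ∈ s, a i) ≤ ∑ i ∈ s, negMulLog (a i) := by
  rw [negMulLog, neg_mul, sum_mul, ← sum_neg_distrib]
  refine sum_le_sum fun i hi => ?_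
  rcases (ha i hi).eq_or_lt with h | h
  · simp [← h]
  · have := log_le_log h (single_le_sum ha hi)
    rw [negMulLog]
    nlinarith

variable [Fintype ι]

lemma sum_fiberSum [Fintype κ] [DecidableEq κ] (p : ι → ℝ) (f : ι → κ) :
    ∑ k, fiberSum p f k = ∑ i, p i :=
  sum_fiberwise _ _ _

lemma fiberSum_nonneg [DecidableEq κ] {p : ι → ℝ} (hp : ∀ i, 0 ≤ p i) (f : ι → κ) (k : κ) :
    0 ≤ fiberSum p f k :=
  sum_nonneg fun i _ => hp i

lemma le_fiberSum [DecidableEq κ] {p : ι → ℝ} (hp : ∀ i, 0 ≤ p i) (f : ι → κ) (i : ι) :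
    p i ≤ fiberSum p f (f i) :=
  single_le_sum (f := p) (fun j _ => hp j) (by simp)

variable [Fintype κ]

lemma fiberSum_mem_stdSimplex [DecidableEq κ] {p : ι → ℝ} (hp : p ∈ stdSimplex ℝ ι) (f : ι → κ) :
    fiberSum p f ∈ stdSimplex ℝ κ :=
  ⟨fiberSum_nonneg hp.1 f, by rw [sum_fiberSum, hp.2]⟩

lemma sum_negMulLog_fiberSum_le [DecidableEq κ] {p : ι → ℝ} (hp : ∀ i, 0 ≤ p i) (f : ι → κ) :
    ∑ k, negMulLog (fiberSum p f k) ≤ ∑ i, negMulLog (p i) :=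
  calc _ ≤ ∑ k, ∑ i with f i = k, negMulLog (p i) :=
        sum_le_sum fun _ _ => negMulLog_sum_le fun i _ => hp i
    _ = _ := sum_fiberwise _ _ _

lemma entropy_le_of_mem_couplings {p : ι → ℝ} {q : κ → ℝ} {N : ι × κ → ℝ}
    (hN : N ∈ couplings p q) : entropy p ≤ entropy N := by
  rw [entropy_eq_sum_negMulLog, entropy_eq_sum_negMulLog, Fintype.sum_prod_type]
  refine div_le_div_of_nonneg_right (sum_le_sum fun i _ => ?_) (log_pos one_lt_two).le
  rw [← hN.2.1 i]
  exact negMulLog_sum_le fun j _ => hN.1.1 _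

lemma dist_fiberSum_le [DecidableEq κ] {p : ι → ℝ} (hp : p ∈ stdSimplex ℝ ι) (f : ι → κ) :
    dist p (fiberSum p f) ≤ entropy p - entropy (fiberSum p f) := by
  classical
  set N : ι × κ → ℝ := fun x => if f x.1 = x.2 then p x.1 else 0 with hN
  have hmem : N ∈ couplings p (fiberSum p f) := by
    refine ⟨⟨fun x => ?_, ?_⟩, fun i => ?_, fun j => ?_⟩
    · simp only [hN]; split_ifs
      exacts [hp.1 _, le_rfl]
    · simp [hN, Fintype.sum_prod_type, hp.2]
    · simp [hN]
    · simp [hN, fiberSum, sum_filter]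
  have hent : entropy N = entropy p := by
    simp [entropy_eq_sum_negMulLog, hN, Fintype.sum_prod_type, apply_ite negMulLog]
  have := (isLeast_minJointEntropy hp (fiberSum_mem_stdSimplex hp f)).2 ⟨N, hmem, rfl⟩
  rw [hent] at this
  unfold dist
  linarith

/-- **Gibbs' inequality**, termwise. -/
lemma mul_log_sub_le {a b c : ℝ} (ha : 0 ≤ a) (hac : a ≤ c) (hb : 0 ≤ b) (hab : a ≠ 0 → 0 < b) :
    a * log b - a * log a + a * log c ≤ b * c - a := by
  rcases ha.eq_or_lt with rfl | ha
  · simpa using mul_nonneg hb hac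
  · have hb := hab ha.ne'
    have hc : 0 < c := ha.trans_le hac
    have h := log_le_sub_one_of_pos (show 0 < b * c / a by positivity)
    rw [log_div (by positivity) ha.ne', log_mul hb.ne' hc.ne'] at h
    calc _ = a * (log b + log c - log a) := by ring
      _ ≤ a * (b * c / a - 1) := by gcongr
      _ = _ := by field_simp

/-- Given a joint distribution of `(X, Y)`, the maximum likelihood estimate `f X` of `Y` satisfies
`H(X | f X) ≤ H(X | Y)`. -/
lemma exists_entropy_sub_entropy_fiberSum_le [Nonempty κ] [DecidableEq κ] {p : ι → ℝ} {q : κ → ℝ}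
    {N : ι × κ → ℝ} (hN : N ∈ couplings p q) :
    ∃ f : ι → κ, entropy p - entropy (fiberSum p f) ≤ entropy N - entropy q := by
  obtain ⟨⟨hN0, -⟩, hNp, hNq⟩ := hN
  have hp0 : ∀ i, 0 ≤ p i := fun i => hNp i ▸ sum_nonneg fun j _ => hN0 _
  have hq0 : ∀ j, 0 ≤ q j := fun j => hNq j ▸ sum_nonneg fun i _ => hN0 _
  have hNqle : ∀ i j, N (i, j) ≤ q j := fun i j =>
    hNq j ▸ single_le_sum (f := fun i => N (i, j)) (fun i _ => hN0 _) (mem_univ i)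
  choose f hf using fun i => Finite.exists_max fun j => N (i, j) / q j
  set w : ι → ℝ := fun i => N (i, f i) / q (f i) with hw
  have hw0 : ∀ i, 0 ≤ w i := fun i => div_nonneg (hN0 _) (hq0 _)
  have hq_pos : ∀ i j, 0 < N (i, j) → 0 < q j := fun i j h => h.trans_le (hNqle i j)
  have hw_pos : ∀ i, p i ≠ 0 → 0 < w i := by
    intro i hi
    rw [← hNp i] at hi
    obtain ⟨j, -, hj⟩ := exists_ne_zero_of_sum_ne_zero hi
    have hj := lt_of_le_of_ne (hN0 _) hj.symm
    exact (div_pos hj (hq_pos i j hj)).trans_le (hf i j)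
  refine ⟨f, ?_⟩
  -- The right side is `H(X | Y)` in nats, and each conditional probability `N (i, j) / q j` is at
  -- most `w i`.
  have hcond : -∑ i, p i * log (w i) ≤
      ∑ x, negMulLog (N x) - ∑ j, negMulLog (q j) := by
    have hqsum : ∑ j, negMulLog (q j) = ∑ i, ∑ j, -(N (i, j) * log (q j)) := by
      rw [sum_comm]
      refine sum_congr rfl fun j _ => ?_
      rw [sum_neg_distrib, ← sum_mul, hNq, negMulLog, neg_mul]
    rw [hqsum, Fintype.sum_prod_type, ← sum_sub_distrib, ← sum_neg_distrib]
    refine sum_le_sum fun i _ => ?_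
    rw [← sum_sub_distrib, ← hNp i, sum_mul, ← sum_neg_distrib]
    refine sum_le_sum fun j _ => ?_
    rcases (hN0 (i, j)).eq_or_lt with h | h
    · simp [← h]
    · have hqj := hq_pos i j h
      have := log_le_log (div_pos h hqj) (hf i j)
      rw [log_div h.ne' hqj.ne'] at this
      simp only [negMulLog, hw]
      nlinarith
  have hgibbs : ∑ i, negMulLog (p i) - ∑ k, negMulLog (fiberSum p f k) ≤
      -∑ i, p i * log (w i) := by
    have hfib : ∑ k, negMulLog (fiberSum p f k) =
        ∑ i, -(p i * log (fiberSum p f (f i))) := by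
      rw [← sum_fiberwise univ f]
      refine sum_congr rfl fun k _ => ?_
      rw [negMulLog, fiberSum, neg_mul, sum_mul, sum_neg_distrib]
      congr 1
      refine sum_congr rfl fun i hi => ?_
      rw [(mem_filter.1 hi).2, fiberSum]
    -- On the fibre of `k`, `w` is part of the conditional law of `X` given `Y = k`, so Gibbs
    -- applies blockwise. If `q k = 0`, the quotients are `0`.
    have hwsum : ∀ k, ∑ i with f i = k, w i ≤ 1 := by
      intro k
      calc ∑ i with f i = k, w i = ∑ i with f i = k, N (i, k) / q k :=
            sum_congr rfl fun i hi => by simp only [hw, (mem_filter.1 hi).2]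
        _ ≤ ∑ i, N (i, k) / q k :=
            sum_le_univ_sum_of_nonneg fun i => div_nonneg (hN0 _) (hq0 _)
        _ = q k / q k := by rw [← sum_div, hNq]
        _ ≤ 1 := div_self_le_one _
    have hkey : ∑ i, (p i * log (w i) - p i * log (p i) + p i * log (fiberSum p f (f i))) ≤ 0 := by
      calc _ ≤ ∑ i, (w i * fiberSum p f (f i) - p i) := sum_le_sum fun i _ =>
            mul_log_sub_le (hp0 i) (le_fiberSum hp0 f i) (hw0 i) (hw_pos i)
        _ = ∑ k, (∑ i with f i = k, w i) * fiberSum p f k - ∑ i, p i := by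
            rw [sum_sub_distrib, ← sum_fiberwise univ f]
            congr 1
            refine sum_congr rfl fun k _ => ?_
            rw [sum_mul]
            exact sum_congr rfl fun i hi => by rw [(mem_filter.1 hi).2]
        _ ≤ ∑ k, 1 * fiberSum p f k - ∑ i, p i := by
            gcongr with k _
            · exact fiberSum_nonneg hp0 f k
            · exact hwsum k
        _ = 0 := by simp [sum_fiberSum]
    rw [hfib]
    simp only [negMulLog, sum_add_distrib, sum_sub_distrib, sum_neg_distrib, neg_mul] at hkey ⊢
    linarith
  simp only [entropy_eq_sum_negMulLog, ← sub_div]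
  exact div_le_div_of_nonneg_right (hgibbs.trans hcond) (log_pos one_lt_two).le

lemma exists_entropy_sub_entropy_fiberSum_le_dist [Nonempty κ] [DecidableEq κ] {p : ι → ℝ}
    {q : κ → ℝ} (hp : p ∈ stdSimplex ℝ ι) (hq : q ∈ stdSimplex ℝ κ) :
    ∃ f : ι → κ, entropy p - entropy (fiberSum p f) ≤ dist p q := by
  obtain ⟨N, hN, hNW⟩ := (isLeast_minJointEntropy hp hq).1
  obtain ⟨f, hf⟩ := exists_entropy_sub_entropy_fiberSum_le hN
  have := entropy_le_of_mem_couplings hN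
  exact ⟨f, by unfold dist; linarith⟩

end Coupling

lemma exists_isBestApprox {n m : ℕ} [Nonempty (Fin m)] {p : Fin n → ℝ}
    (hp : p ∈ stdSimplex ℝ (Fin n)) : ∃ q : Fin m → ℝ, IsBestApprox p q := by
  obtain ⟨f, hf⟩ := Finite.exists_max fun f : Fin n → Fin m => entropy (fiberSum p f)
  refine ⟨fiberSum p f, fiberSum_mem_stdSimplex hp f, fun q hq => ?_⟩
  obtain ⟨g, hg⟩ := exists_entropy_sub_entropy_fiberSum_le_dist hp hq
  linarith [dist_fiberSum_le hp f, hf g]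

/-! ### The tangent defect of the entropy function -/

/-- The difference at `t` between `t ↦ -t log t` and its tangent at `c`. -/
noncomputable def tangentDefect (c t : ℝ) : ℝ := negMulLog t + t * log c + t - c

lemma tangentDefect_nonpos {c t : ℝ} (hc : 0 < c) (ht : 0 ≤ t) : tangentDefect c t ≤ 0 := by
  rcases ht.eq_or_lt with rfl | ht
  · simp [tangentDefect, hc.le]
  · have h := log_le_sub_one_of_pos (div_pos hc ht)
    rw [log_div hc.ne' ht.ne'] at h
    have : t * (log c - log t) ≤ t * (c / t - 1) := by gcongr
    have e : t * (c / t - 1) = c - t := by field_simp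
    simp only [tangentDefect, negMulLog]
    linarith

lemma tangentDefect_le_tangentDefect {c s t : ℝ} (hc : 0 < c) (hs : c ≤ s) (hst : s ≤ t) :
    tangentDefect c t ≤ tangentDefect c s := by
  have hs0 := hc.trans_le hs
  have ht0 := hs0.trans_le hst
  have h := log_le_sub_one_of_pos (div_pos hs0 ht0)
  rw [log_div hs0.ne' ht0.ne'] at h
  have h1 : t * (log s - log t) ≤ t * (s / t - 1) := by gcongr
  have e : t * (s / t - 1) = s - t := by field_simp
  have h2 : (t - s) * log c ≤ (t - s) * log s :=
    mul_le_mul_of_nonneg_left (log_le_log hc hs) (by linarith)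
  simp only [tangentDefect, negMulLog]
  linarith

/-- Splitting `a + b` gains entropy at least the harmonic mean `2ab / (a + b) ≥ c`, which pays for
the extra constant `-c`. -/
lemma tangentDefect_add_le {c a b : ℝ} (hc : 0 < c) (ha : c ≤ a) (hb : c ≤ b) :
    tangentDefect c (a + b) ≤ tangentDefect c a + tangentDefect c b := by
  have key : ∀ x y : ℝ, 0 < x → 0 < y → x * y / (x + y) ≤ x * log (x + y) - x * log x := by
    intro x y hx hy
    have h := one_sub_inv_le_log_of_pos (show 0 < (x + y) / x by positivity)
    rw [log_div (by positivity) hx.ne'] at h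
    calc x * y / (x + y) = x * (1 - ((x + y) / x)⁻¹) := by field_simp; ring
      _ ≤ x * (log (x + y) - log x) := by gcongr
      _ = _ := by ring
  have ha0 := hc.trans_le ha
  have hb0 := hc.trans_le hb
  have h1 := key a b ha0 hb0
  have h2 := key b a hb0 ha0
  rw [add_comm b a, mul_comm b a] at h2
  have h3 : c / 2 ≤ a * b / (a + b) := by
    rw [div_le_div_iff₀ two_pos (by positivity)]
    nlinarith
  simp only [tangentDefect, negMulLog]
  linarith

/-- The slack in `t` stands for the light elements of a block: beyond `c` the defect decreases, so
they only help. -/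
lemma tangentDefect_le_sum {ι : Type*} {c : ℝ} (hc : 0 < c) {p : ι → ℝ} (s : Finset ι)
    (hp : ∀ i ∈ s, c ≤ p i) : ∀ {t : ℝ}, ∑ i ∈ s, p i ≤ t →
      tangentDefect c t ≤ ∑ i ∈ s, tangentDefect c (p i) := by
  classical
  induction s using Finset.induction_on with
  | empty => exact fun ht => by simpa using tangentDefect_nonpos hc (by simpa using ht)
  | insert a s ha ih =>
    intro t ht
    have hps : ∀ i ∈ s, c ≤ p i := fun i hi => hp i (mem_insert_of_mem hi)
    have hpa := hp a (mem_insert_self a s)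
    rw [sum_insert ha] at ht ⊢
    rcases s.eq_empty_or_nonempty with rfl | ⟨i, hi⟩
    · simp only [sum_empty, add_zero] at ht ⊢
      exact tangentDefect_le_tangentDefect hc hpa ht
    · have hsum : p i ≤ ∑ j ∈ s, p j :=
        single_le_sum (fun j hj => hc.le.trans (hps j hj)) hi
      have h := tangentDefect_add_le hc hpa (b := t - p a) (by linarith [hps i hi])
      rw [add_sub_cancel] at h
      linarith [ih hps (t := t - p a) (by linarith)]

/-! ### The constant -/

lemma alpha_mul_log_two : alpha * log 2 = log 2 - 1 - log (log 2) := by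
  have : log 2 ≠ 0 := (log_pos one_lt_two).ne'
  rw [alpha]
  field_simp
  ring

lemma alpha_nonneg : 0 ≤ alpha := by
  have h := log_pos one_lt_two
  have := log_le_sub_one_of_pos h
  have := alpha_mul_log_two
  by_contra! hneg
  nlinarith

lemma alpha_lt : alpha < 0.0861 := by
  have h1 := log_two_gt_d9
  have h2 := log_two_lt_d9
  -- `-0.36652` lies just below `log (log 2)`.
  have hexp : exp (-0.36652) ≤ log 2 := by
    have h := sum_le_exp_of_nonneg (x := 0.36652) (by norm_num) 8
    rw [exp_neg]
    have h' : (1.4427 : ℝ) ≤ exp 0.36652 :=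
      h.trans' (by norm_num [sum_range_succ, Nat.factorial])
    exact (inv_anti₀ (by norm_num) h').trans (h1.le.trans' (by norm_num))
  have hlog := (le_log_iff_exp_le (log_pos one_lt_two)).2 hexp
  have := alpha_mul_log_two
  by_contra! hge
  nlinarith

/-- On an interval `[μ, 2 μ]` the tangent at `2 μ log 2` approximates `-t log t` up to
`(α log 2) t`. -/
lemma tangentDefect_add_alpha_nonneg {μ t : ℝ} (hμ : 0 < μ) (h1 : μ ≤ t) (h2 : t ≤ 2 * μ) :
    0 ≤ tangentDefect (2 * log 2 * μ) t + alpha * log 2 * t := by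
  have hl := log_pos one_lt_two
  have ht := hμ.trans_le h1
  have hst : μ / t ≤ 1 := (div_le_one ht).2 h1
  have hst' : 1 / 2 ≤ μ / t := by rw [div_le_div_iff₀ two_pos ht]; linarith
  -- With `s = μ / t`, the claim divided by `t` is `log s ≥ -2 (1 - s) log 2`: the logarithm lies
  -- above its chord on `[1/2, 1]`. Equality at both ends dictates `c` and `α`.
  have h := strictConcaveOn_log_Ioi.concaveOn.2
    (show (1 / 2 : ℝ) ∈ Set.Ioi 0 by simp) (show (1 : ℝ) ∈ Set.Ioi 0 by simp)
    (show 0 ≤ 2 * (1 - μ / t) by linarith) (show 0 ≤ 2 * (μ / t) - 1 by linarith) (by ring)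
  have e : 2 * (1 - μ / t) * 2⁻¹ + (2 * (μ / t) - 1) * 1 = μ / t := by ring
  simp only [smul_eq_mul, e, log_one, mul_zero, add_zero, one_div, log_inv] at h
  rw [log_div hμ.ne' ht.ne'] at h
  have h' := mul_le_mul_of_nonneg_left h ht.le
  have e' : t * (2 * (1 - μ / t) * -log 2) = 2 * log 2 * μ - 2 * log 2 * t := by
    field_simp
    ring
  rw [e'] at h'
  rw [tangentDefect, alpha_mul_log_two, negMulLog, log_mul (by positivity) hμ.ne',
    log_mul two_ne_zero hl.ne']
  linarith

/-! ### The Huffman algorithm -/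

lemma exists_huffmanStep {s : Multiset ℝ} (hs : 2 ≤ s.card) :
    ∃ t, HuffmanStep s t ∧ t.card + 1 = s.card := by
  have hlen : 2 ≤ (s.sort (· ≤ ·)).length := by simpa using hs
  have hpw := s.pairwise_sort (· ≤ ·)
  have heq := s.sort_eq (· ≤ ·)
  match hl : s.sort (· ≤ ·) with
  | [] => simp [hl] at hlen
  | [x] => simp [hl] at hlen
  | x :: y :: u =>
    rw [hl] at hpw heq
    obtain ⟨hx, hy⟩ := List.pairwise_cons.1 hpw
    refine ⟨(x + y) ::ₘ (u : Multiset ℝ), ⟨x, y, u, ?_, hx y (by simp), ?_, rfl⟩, ?_⟩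
    · rw [← heq]; rfl
    · exact fun z hz => (List.pairwise_cons.1 hy).1 z hz
    · rw [← heq]; simp

lemma exists_huffmanSteps (k : ℕ) : ∀ {s : Multiset ℝ}, k + 1 ≤ s.card →
    ∃ t, HuffmanSteps k s t ∧ t.card + k = s.card := by
  induction k with
  | zero => exact fun {s} _ => ⟨s, .zero s, rfl⟩
  | succ k ih =>
    intro s hs
    obtain ⟨t, hst, ht⟩ := exists_huffmanStep (s := s) (by omega)
    obtain ⟨u, htu, hu⟩ := ih (s := t) (by omega)
    exact ⟨u, .succ hst htu, by omega⟩

lemma exists_antitone_map_eq {m : ℕ} {t : Multiset ℝ} (ht : t.card = m) :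
    ∃ q : Fin m → ℝ, Antitone q ∧ univ.val.map q = t := by
  subst ht
  have hlen : (t.sort (· ≥ ·)).length = t.card := t.length_sort _
  have hanti : Antitone (t.sort (· ≥ ·)).get := (t.pairwise_sort (· ≥ ·)).sortedGE.antitone_get
  have hmap : univ.val.map (t.sort (· ≥ ·)).get = t := by
    rw [Fin.univ_val_map, List.ofFn_get, Multiset.sort_eq]
  generalize (t.sort (· ≥ ·)) = l at *
  revert hlen
  generalize t.card = k
  rintro rfl
  exact ⟨_, hanti, hmap⟩

lemma exists_isHuffmanOutput {n m : ℕ} (hm : 1 ≤ m) (hmn : m ≤ n) (p : Fin n → ℝ) :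
    ∃ q : Fin m → ℝ, IsHuffmanOutput p q := by
  obtain ⟨t, hst, ht⟩ := exists_huffmanSteps (n - m) (s := univ.val.map p) (by simp; omega)
  obtain ⟨q, hq, rfl⟩ := exists_antitone_map_eq (m := m) (t := t) (by simp at ht; omega)
  exact ⟨q, hq, hst⟩

/-! ### Lifting equal multisets of values to bijections of indices -/

section Matching

variable {α β γ : Type*} [DecidableEq α] [DecidableEq β]

lemma exists_mem_map_erase_eq {A : Finset α} {g : α → γ} {x : γ} {u : Multiset γ}
    (h : A.val.map g = x ::ₘ u) : ∃ a ∈ A, g a = x ∧ (A.erase a).val.map g = u := by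
  obtain ⟨a, ha, rfl⟩ := Multiset.mem_map.1 (h ▸ Multiset.mem_cons_self x u)
  refine ⟨a, ha, rfl, ?_⟩
  rwa [← insert_erase ha, insert_val_of_notMem (notMem_erase a A), Multiset.map_cons,
    Multiset.cons_inj_right] at h

lemma exists_bijOn_of_map_eq_map [Nonempty β] (A : Finset α) :
    ∀ {B : Finset β} {g : α → γ} {q : β → γ}, A.val.map g = B.val.map q →
      ∃ e : α → β, Set.BijOn e A B ∧ ∀ a ∈ A, q (e a) = g a := by
  induction A using Finset.induction_on with
  | empty =>
    intro B g q h
    obtain rfl : B = ∅ := by simpa [eq_comm] using h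
    exact ⟨fun _ => Classical.arbitrary β, by simp, by simp⟩
  | insert a A ha ih =>
    intro B g q h
    rw [insert_val_of_notMem ha, Multiset.map_cons, eq_comm] at h
    obtain ⟨b, hb, hba, h⟩ := exists_mem_map_erase_eq h
    obtain ⟨e, he, heq⟩ := ih h.symm
    have hupd : ∀ x ∈ A, Function.update e a b x = e x := fun x hx =>
      Function.update_of_ne (ne_of_mem_of_not_mem hx ha) _ _
    refine ⟨Function.update e a b, ?_, fun x hx => ?_⟩
    · have := (he.congr fun x hx => (hupd x hx).symm).insert (a := a) (by simp)
      rwa [Function.update_self, ← coe_insert, ← coe_insert, insert_erase hb] at this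
    · rcases mem_insert.1 hx with rfl | hx
      · rw [Function.update_self, hba]
      · rw [hupd x hx, heq x hx]

end Matching

/-- The multiset `t` consists of the sums of `p` over the blocks of the partition into fibres of
`f`, and the sum over a block with more than one element is at most twice any element of `t`. -/
def IsHuffmanPartition {ι κ : Type*} [Fintype ι] [DecidableEq κ] (p : ι → ℝ) (f : ι → κ)
    (t : Multiset ℝ) : Prop :=
  (univ.image f).val.map (fiberSum p f) = t ∧
    ∀ i, (∀ j, f j = f i → j = i) ∨ ∀ z ∈ t, fiberSum p f (f i) ≤ 2 * z

/-! ### The block invariant under Huffman steps -/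

section Partition

variable {ι : Type*} [Fintype ι] [DecidableEq ι] {p : ι → ℝ}

lemma isHuffmanPartition_id (p : ι → ℝ) : IsHuffmanPartition p id (univ.val.map p) := by
  refine ⟨?_, fun i => .inl fun j h => h⟩
  rw [image_id]
  congr 1
  funext i
  simp [fiberSum, filter_eq']

/-- The merged block has sum `x + y ≤ 2y`, and `y` bounds every element of `t` from below. An older
composite block has sum at most `2x ≤ 2y`. -/
lemma IsHuffmanPartition.exists_of_huffmanStep {f : ι → ι} {s t : Multiset ℝ}
    (hp : ∀ i, 0 ≤ p i) (hf : IsHuffmanPartition p f s) (hst : HuffmanStep s t) :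
    ∃ f' : ι → ι, IsHuffmanPartition p f' t := by
  obtain ⟨x, y, u, rfl, hxy, hyu, rfl⟩ := hst
  obtain ⟨hmap, hdouble⟩ := hf
  obtain ⟨a, ha, rfl, hmap_a⟩ := exists_mem_map_erase_eq hmap
  obtain ⟨b, hb, rfl, hmap_b⟩ := exists_mem_map_erase_eq hmap_a
  have hba : b ≠ a := ne_of_mem_erase hb
  have hx0 : 0 ≤ fiberSum p f a := fiberSum_nonneg hp f a
  set f' : ι → ι := fun i => if f i = b then a else f i with hf'
  have himg : univ.image f' = insert a (((univ.image f).erase a).erase b) := by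
    ext k
    obtain ⟨i₀, hi₀⟩ : ∃ i, f i = a := by simpa using ha
    simp only [mem_image, mem_univ, true_and, mem_insert, mem_erase, hf']
    constructor
    · rintro ⟨i, rfl⟩
      split_ifs with h
      · exact .inl rfl
      · by_cases h' : f i = a
        · exact .inl h'
        · exact .inr ⟨h, h', i, rfl⟩
    · rintro (rfl | ⟨h, -, i, rfl⟩)
      · exact ⟨i₀, by rw [hi₀, if_neg hba.symm]⟩
      · exact ⟨i, if_neg h⟩
  have hsum_a : fiberSum p f' a = fiberSum p f a + fiberSum p f b := by
    simp only [fiberSum, sum_filter, ← sum_add_distrib, hf']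
    refine sum_congr rfl fun i _ => ?_
    by_cases h : f i = b
    · simp [h, hba]
    · simp [h]
  have hsum : ∀ k, k ≠ a → k ≠ b → fiberSum p f' k = fiberSum p f k := by
    intro k hka hkb
    simp only [fiberSum, sum_filter, hf']
    refine sum_congr rfl fun i _ => ?_
    by_cases h : f i = b
    · simp [h, hka.symm, hkb.symm]
    · simp [h]
  refine ⟨f', ?_, fun i => ?_⟩
  · rw [himg, insert_val_of_notMem (by simp), Multiset.map_cons, hsum_a, ← hmap_b]
    congr 1
    refine Multiset.map_congr rfl fun k hk => ?_
    have hk : k ∈ ((univ.image f).erase a).erase b := hk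
    exact hsum k (ne_of_mem_erase (mem_of_mem_erase hk)) (ne_of_mem_erase hk)
  · have hle : ∀ z ∈ (fiberSum p f a + fiberSum p f b) ::ₘ u, fiberSum p f b ≤ z := by
      intro z hz
      rcases Multiset.mem_cons.1 hz with rfl | hz
      exacts [by linarith, hyu z hz]
    by_cases hi : f' i = a
    · right
      intro z hz
      rw [hi, hsum_a]
      linarith [hle z hz]
    · have hib : f i ≠ b := fun h => hi (if_pos h)
      have hfi : f' i = f i := if_neg hib
      rw [hfi] at hi ⊢
      rcases hdouble i with h | h
      · refine .inl fun j hj => h j ?_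
        by_cases hjb : f j = b
        · exact absurd (hj ▸ (if_pos hjb : f' j = a)) hi
        · exact (if_neg hjb : f' j = f j).symm.trans hj
      · right
        intro z hz
        rw [hsum _ hi hib]
        linarith [h (fiberSum p f a) (by simp), hle z hz]

lemma IsHuffmanPartition.exists_of_huffmanSteps {k : ℕ} {s t : Multiset ℝ} (hp : ∀ i, 0 ≤ p i)
    (hst : HuffmanSteps k s t) : ∀ {f : ι → ι}, IsHuffmanPartition p f s →
      ∃ f' : ι → ι, IsHuffmanPartition p f' t := by
  induction hst with
  | zero s => exact fun {f} hf => ⟨f, hf⟩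
  | succ hst _ ih =>
    intro f hf
    obtain ⟨f', hf'⟩ := hf.exists_of_huffmanStep hp hst
    exact ih hf'

end Partition

/-- The blocks of a Huffman output: a block with more than one element has a sum that is at most
twice the sum over any block. -/
lemma IsHuffmanOutput.exists_blocks {n m : ℕ} [Nonempty (Fin m)] {p : Fin n → ℝ} {q : Fin m → ℝ}
    (hp : ∀ i, 0 ≤ p i) (hq : IsHuffmanOutput p q) :
    ∃ f : Fin n → Fin m, Function.Surjective f ∧ q = fiberSum p f ∧
      ∀ i, (∀ j, f j = f i → j = i) ∨ ∀ k, q (f i) ≤ 2 * q k := by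
  obtain ⟨f, hmap, hf⟩ := IsHuffmanPartition.exists_of_huffmanSteps hp hq.2
    (isHuffmanPartition_id p)
  obtain ⟨e, he, heq⟩ := exists_bijOn_of_map_eq_map _ hmap
  have hmem : ∀ i, f i ∈ (univ.image f : Finset (Fin n)) := fun i => mem_image_of_mem f (mem_univ i)
  have hiff : ∀ i j, e (f i) = e (f j) ↔ f i = f j := fun i j =>
    he.injOn.eq_iff (hmem i) (hmem j)
  have hsurj : Function.Surjective fun i => e (f i) := by
    intro k
    obtain ⟨a, ha, rfl⟩ := he.surjOn (mem_coe.2 (mem_univ k))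
    obtain ⟨i, -, rfl⟩ := mem_image.1 (mem_coe.1 ha)
    exact ⟨i, rfl⟩
  refine ⟨fun i => e (f i), hsurj, ?_, fun i => ?_⟩
  · funext k
    obtain ⟨i, rfl⟩ := hsurj k
    simp only [heq _ (hmem i), fiberSum, hiff]
  · simp only [hiff, heq _ (hmem i)]
    exact (hf i).imp_right fun h k => h _ (Multiset.mem_map_of_mem q (mem_univ_val k))

/-! ### The approximation bound -/

/-- A partition whose blocks with more than one element have sums at most twice every block sum
has nearly the largest entropy among all partitions. -/
lemma sum_negMulLog_fiberSum_le_add {ι κ : Type*} [Fintype ι] [Fintype κ] [Nonempty κ]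
    [DecidableEq κ] {p : ι → ℝ} (hp : p ∈ stdSimplex ℝ ι) {f : ι → κ}
    (hfs : Function.Surjective f)
    (hf : ∀ i, (∀ j, f j = f i → j = i) ∨ ∀ k, fiberSum p f (f i) ≤ 2 * fiberSum p f k)
    (g : ι → κ) :
    ∑ k, negMulLog (fiberSum p g k) ≤ ∑ k, negMulLog (fiberSum p f k) + alpha * log 2 := by
  set q := fiberSum p f with hq
  have hq0 : ∀ k, 0 ≤ q k := fiberSum_nonneg hp.1 f
  have hα : 0 ≤ alpha * log 2 := mul_nonneg alpha_nonneg (log_pos one_lt_two).le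
  obtain ⟨k₀, hk₀⟩ := Finite.exists_min q
  have hsingle : ∀ i, 2 * q k₀ < q (f i) → ∀ j, f j = f i → j = i := fun i hi =>
    (hf i).resolve_right fun h => (h k₀).not_gt hi
  have hpq : ∀ i, 2 * q k₀ < q (f i) → q (f i) = p i := by
    intro i hi
    have : univ.filter (fun j => f j = f i) = {i} := by
      ext j
      simpa using ⟨hsingle i hi j, fun h => h ▸ rfl⟩
    rw [hq, fiberSum, this, sum_singleton]
  have hbij : ∀ F : ℝ → ℝ, ∑ i with 2 * q k₀ < q (f i), F (p i) =
      ∑ k with 2 * q k₀ < q k, F (q k) := by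
    intro F
    refine sum_bij (fun i _ => f i) ?_ ?_ ?_ ?_
    · exact fun i hi => by simpa using hi
    · exact fun i _ j hj h => hsingle j (mem_filter.1 hj).2 i h
    · intro k hk
      obtain ⟨i, rfl⟩ := hfs k
      exact ⟨i, by simpa using hk, rfl⟩
    · exact fun i hi => by rw [hpq i (mem_filter.1 hi).2]
  -- If the least block sum is `0`, every block of positive sum is a single element, so `q` has the
  -- full entropy of `p`.
  rcases (hq0 k₀).eq_or_lt with h0 | hpos
  · have hzero : ∀ k, ¬ 2 * q k₀ < q k → q k = 0 := fun k hk =>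
      le_antisymm (by linarith) (hq0 k)
    calc ∑ k, negMulLog (fiberSum p g k) ≤ ∑ i, negMulLog (p i) :=
          sum_negMulLog_fiberSum_le hp.1 g
      _ = ∑ i with 2 * q k₀ < q (f i), negMulLog (p i) := by
          refine (sum_filter_of_ne fun i _ hi => ?_).symm
          by_contra h
          have : p i = 0 := le_antisymm ((le_fiberSum hp.1 f i).trans (hzero _ h).le) (hp.1 i)
          simp [this] at hi
      _ = ∑ k with 2 * q k₀ < q k, negMulLog (q k) := hbij _
      _ = ∑ k, negMulLog (q k) := by
          refine sum_filter_of_ne fun k _ hk => ?_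
          by_contra h
          simp [hzero k h] at hk
      _ ≤ _ := by linarith
  · have hl : log 2 < 1 := log_two_lt_d9.trans (by norm_num)
    set c := 2 * log 2 * q k₀ with hc
    have hc0 : 0 < c := by have := log_pos one_lt_two; positivity
    have hc2 : c ≤ 2 * q k₀ := by nlinarith
    -- The tangent is affine, so its total depends only on the mass and the number of components.
    have hdefect : ∀ r : κ → ℝ, ∑ k, r k = 1 → ∑ k, tangentDefect c (r k) =
        ∑ k, negMulLog (r k) + (log c + 1 - Fintype.card κ * c) := by
      intro r hr
      simp only [tangentDefect, sum_sub_distrib, sum_add_distrib, ← sum_mul, hr, sum_const,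
        card_univ, nsmul_eq_mul]
      ring
    -- In each block of `g`, keep only the elements that form heavy blocks of `f`; each exceeds `2 *
    -- q k₀ ≥ c`.
    have hg : ∑ k, tangentDefect c (fiberSum p g k) ≤
        ∑ k with 2 * q k₀ < q k, tangentDefect c (q k) := by
      rw [← hbij, ← sum_fiberwise _ g]
      refine sum_le_sum fun k _ => tangentDefect_le_sum hc0 _ (fun i hi => ?_) ?_
      · have hi := (mem_filter.1 (mem_filter.1 hi).1).2
        rw [← hpq i hi]
        linarith
      · refine sum_le_sum_of_subset_of_nonneg (fun i hi => ?_) fun i _ _ => hp.1 i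
        simp only [mem_filter, mem_univ, true_and] at hi ⊢
        exact hi.2
    have hrest : 0 ≤ ∑ k with ¬ 2 * q k₀ < q k, (tangentDefect c (q k) + alpha * log 2 * q k) :=
      sum_nonneg fun k hk => tangentDefect_add_alpha_nonneg hpos (hk₀ k)
        (not_lt.1 (mem_filter.1 hk).2)
    have hmass : ∑ k with ¬ 2 * q k₀ < q k, q k ≤ 1 := by
      rw [← (fiberSum_mem_stdSimplex hp f).2]
      exact sum_le_univ_sum_of_nonneg hq0
    rw [sum_add_distrib, ← mul_sum] at hrest
    have hsplit := sum_filter_add_sum_filter_not univ (fun k => 2 * q k₀ < q k)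
      fun k => tangentDefect c (q k)
    rw [hdefect q (fiberSum_mem_stdSimplex hp f).2] at hsplit
    rw [hdefect _ (fiberSum_mem_stdSimplex hp g).2] at hg
    nlinarith [mul_le_mul_of_nonneg_left hmass hα]

end HuffmanApprox

theorem mainTheorem5 (n m : ℕ) (hm : 1 ≤ m) (hmn : m ≤ n)
    (p : Fin n → ℝ) (hp : p ∈ stdSimplex ℝ (Fin n)) :
    (∃ qbar : Fin m → ℝ, HuffmanApprox.IsHuffmanOutput p qbar) ∧
    (∃ qstar : Fin m → ℝ, HuffmanApprox.IsBestApprox p qstar) ∧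
    (∀ qbar : Fin m → ℝ, HuffmanApprox.IsHuffmanOutput p qbar →
      HuffmanApprox.IsAggregation p qbar ∧
      ∀ qstar : Fin m → ℝ, HuffmanApprox.IsBestApprox p qstar →
        HuffmanApprox.dist p qbar ≤ HuffmanApprox.dist p qstar + HuffmanApprox.alpha) ∧
    HuffmanApprox.alpha < 0.0861 := by
  have : Nonempty (Fin m) := ⟨⟨0, hm⟩⟩
  refine ⟨HuffmanApprox.exists_isHuffmanOutput hm hmn p, HuffmanApprox.exists_isBestApprox hp,
    fun qbar hqbar => ?_, HuffmanApprox.alpha_lt⟩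
  obtain ⟨f, hfs, rfl, hf⟩ := hqbar.exists_blocks hp.1
  refine ⟨⟨f, hfs, fun _ => rfl⟩, fun qstar hqstar => ?_⟩
  obtain ⟨g, hg⟩ := HuffmanApprox.exists_entropy_sub_entropy_fiberSum_le_dist hp hqstar.1
  have hle := HuffmanApprox.sum_negMulLog_fiberSum_le_add hp hfs hf g
  have hl := Real.log_pos one_lt_two
  have hent : HuffmanApprox.entropy (HuffmanApprox.fiberSum p g) ≤
      HuffmanApprox.entropy (HuffmanApprox.fiberSum p f) + HuffmanApprox.alpha := by
    rw [HuffmanApprox.entropy_eq_sum_negMulLog, HuffmanApprox.entropy_eq_sum_negMulLog,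
      div_add' _ _ _ hl.ne']
    exact div_le_div_of_nonneg_right hle hl.le
  linarith [HuffmanApprox.dist_fiberSum_le hp f]
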